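/- Let $R$ be an associative ring with unit and let $M$ be a left $R$-module. A module $X$ is $M$-generated if it is an epimorphic image of a direct sum of copies of $M$, and $\sigma[M]$ is the class of modules isomorphic to a submodule of an $M$-generated module. Suppose that $M$ is a progenerator of $\sigma[M]$, that is, $M$ is projective in $\sigma[M]$ (every homomorphism $M\to B$ lifts along every epimorphism $A\to B$ with $A,B\in\sigma[M]$) and every module in $\sigma[M]$ is $M$-generated ($M$ need not be finitely generated). Suppose that $M$ is semiprime, that is, for every fully invariant submodule $K\le M$, if $\sum\{f(K)\mid f\in\mathrm{Hom}_R(M,K)\}=0$ then $K=0$. Suppose that $M$ is a Goldie module, that is, $M$ has finite uniform dimension (it contains no infinite direct sum of nonzero submodules) and satisfies the ascending chain condition on submodules of the form $\bigcap_{f\in X}\ker f$ with $X\subseteq\mathrm{End}_R(M)$. A module $S\in\sigma[M]$ is $M$-singular if there is an exact sequence $0\to K\to L\to S\to 0$ in $\sigma[M]$ with the image of $K$ essential in $L$. For $N\in\sigma[M]$ put $$\mathcal Z(N)=\sum\{f(S)\mid S \text{ is } M\text{-singular},\ f\in\mathrm{Hom}_R(S,N)\}.$$ Then, for every $N\in\sigma[M]$,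 $$\mathcal Z(N)=\sum f(M),$$ where the sum is over all homomorphisms $f:M\to N$ for which there is a monomorphism $\alpha\in\mathrm{End}_R(M)$ with $\alpha(M)$ essential in $M$ and $f\alpha=0$. -/

import Mathlib

universe u v

namespace SigmaCat

section Sigma

variable (R : Type u) [Ring R] (M : Type v) [AddCommGroup M] [Module R M]

/-- `X` is `M`-generated: there is an epimorphism from a direct sum of copies of `M` onto `X`. -/
def IsGenerated (X : Type v) [AddCommGroup X] [Module R X] : Prop :=
  ∃ (ι : Type v) (p : (ι →₀ M) →ₗ[R] X), Function.Surjective p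

/-- `X ∈ σ[M]`: `X` is isomorphic to a submodule of an `M`-generated module. -/
def InSigma (X : Type v) [AddCommGroup X] [Module R X] : Prop :=
  ∃ (Y : Type v) (_ : AddCommGroup Y) (_ : Module R Y),
    IsGenerated R M Y ∧ ∃ j : X →ₗ[R] Y, Function.Injective j

/-- `M` is projective in `σ[M]`: maps out of `M` lift along the epimorphisms of `σ[M]`. -/
def IsProjectiveInSigma : Prop :=
  ∀ (A B : Type v) [AddCommGroup A] [Module R A] [AddCommGroup B] [Module R B],
    InSigma R M A → InSigma R M B →
    ∀ (g : A →ₗ[R] B) (f : M →ₗ[R] B), Function.Surjective g → ∃ h : M →ₗ[R] A, g ∘ₗ h = f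

/-- `M` is a generator of `σ[M]`: every module of `σ[M]` is `M`-generated. -/
def IsGeneratorOfSigma : Prop :=
  ∀ (X : Type v) [AddCommGroup X] [Module R X], InSigma R M X → IsGenerated R M X

/-- `M` is a progenerator of `σ[M]`: a projective generator of `σ[M]`. Finite generation of `M`
is not required, so the notion also covers the convention under which it is. -/
structure IsProgenerator : Prop where
  projective : IsProjectiveInSigma R M
  generator : IsGeneratorOfSigma R M

end Sigma

section Submodules

variable {R : Type u} [Ring R] {M : Type v} [AddCommGroup M] [Module R M]

/-- `N ≤ₑ M`: `N` meets every nonzero submodule of `M` nontrivially. -/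
def IsEssentialSubmodule (N : Submodule R M) : Prop :=
  ∀ K : Submodule R M, N ⊓ K = ⊥ → K = ⊥

/-- The product `K_M L = ∑ {f(K) | f ∈ Hom_R(M, L)}`, as a submodule of `M`. -/
def submoduleProd (K L : Submodule R M) : Submodule R M :=
  ⨆ f : M →ₗ[R] L, K.map (L.subtype ∘ₗ f)

/-- A semiprime submodule `N` of `M`: `N` is fully invariant, and `K_M K ≤ N` implies `K ≤ N`
for every fully invariant submodule `K` of `M`. -/
def IsSemiprimeSubmodule (N : Submodule R M) : Prop :=
  N.IsFullyInvariant ∧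
    ∀ K : Submodule R M, K.IsFullyInvariant → submoduleProd K K ≤ N → K ≤ N

/-- The left annihilator `⋂ {ker f | f ∈ X}` in `M` of a set `X` of endomorphisms of `M`. -/
def leftAnnihilator (X : Set (Module.End R M)) : Submodule R M :=
  ⨅ f ∈ X, LinearMap.ker f

end Submodules

section Goldie

variable (R : Type u) [Ring R] (M : Type v) [AddCommGroup M] [Module R M]

/-- `M` is a semiprime module: `0` is a semiprime submodule of `M`. -/
def IsSemiprimeModule : Prop := IsSemiprimeSubmodule (⊥ : Submodule R M)

/-- `M` has finite uniform (Goldie) dimension: `M` contains no infinite direct sum of nonzero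
submodules. -/
def HasFiniteUniformDim : Prop :=
  ¬ ∃ U : ℕ → Submodule R M, iSupIndep U ∧ ∀ n, U n ≠ ⊥

/-- Every ascending chain of left annihilators in `M` becomes stationary. -/
def HasACCLeftAnnihilators : Prop :=
  ∀ A : ℕ → Submodule R M, Monotone A →
    (∀ n, ∃ X : Set (Module.End R M), A n = leftAnnihilator X) → ∃ n, ∀ m, n ≤ m → A m = A n

/-- `M` is a Goldie module. -/
structure IsGoldieModule : Prop where
  acc : HasACCLeftAnnihilators R M
  finiteUniformDim : HasFiniteUniformDim R M

end Goldie

section Singular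

variable (R : Type u) [Ring R] (M : Type v) [AddCommGroup M] [Module R M]

/-- `N` is `M`-singular: `N ∈ σ[M]` and there is an exact sequence `0 → K → L → N → 0` in `σ[M]`
in which the image of `K` is essential in `L`. -/
def IsMSingular (N : Type v) [AddCommGroup N] [Module R N] : Prop :=
  InSigma R M N ∧
    ∃ (K L : Type v) (_ : AddCommGroup K) (_ : Module R K) (_ : AddCommGroup L) (_ : Module R L)
      (i : K →ₗ[R] L) (p : L →ₗ[R] N),
      InSigma R M K ∧ InSigma R M L ∧
      Function.Injective i ∧ Function.Exact i p ∧ Function.Surjective p ∧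
      IsEssentialSubmodule (LinearMap.range i)

/-- The `M`-singular submodule `𝒵(N) = ∑ {f(X) | X is M-singular, f ∈ Hom_R(X, N)}`. -/
def mSingularSubmodule (N : Type v) [AddCommGroup N] [Module R N] : Submodule R N :=
  sSup {A : Submodule R N | ∃ (X : Type v) (_ : AddCommGroup X) (_ : Module R X)
    (f : X →ₗ[R] N), IsMSingular R M X ∧ A = LinearMap.range f}

end Singular

end SigmaCat

/-! The point is a Goldie-type theorem: every essential submodule `E` of `M` contains the image of a
monomorphism `α : M → M`, and finite uniform dimension makes that image essential. If `S = L/K` with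
`K` essential in `L`, then `L` is a sum of images of maps `h : M → L`; applying this to `h⁻¹(K)`
shows that `M → L → S → N` is killed by some `α`. Conversely, a map killed by `α` factors through
the `M`-singular module `M/α(M)`. To find `α`, semiprimeness passes to `End(M)`, and the chain
condition on kernels then gives, inside any nonzero submodule, a nonzero endomorphism whose image
misses its kernel. Adding such maps inside `E` shrinks the kernel until finite dimension stops the
process. -/

namespace SigmaCat

/-! ### Independence of sequences of submodules -/

section Independence

/-- A sequence `U` is independent as soon as every `U n` is disjoint from some `V n` that lies
above all later terms. -/
theorem iSupIndep_nat_of_disjoint_tail {R : Type*} [Ring R] {M : Type*} [AddCommGroup M]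
    [Module R M] (U V : ℕ → Submodule R M) (hUV : ∀ n, Disjoint (U n) (V n))
    (hV : ∀ n k, n < k → U k ≤ V n) : iSupIndep U := by
  classical
  refine iSupIndep_of_dfinsupp_lsum_injective U ?_
  rw [← LinearMap.ker_eq_bot, LinearMap.ker_eq_bot']
  intro w hw
  ext n : 1
  induction n using Nat.strong_induction_on with
  | _ n ih =>
    have hsum : ∑ k ∈ w.support, (w k : M) = 0 := by
      have h := hw
      rw [DFinsupp.lsum_apply_apply, DFinsupp.sumAddHom_apply, DFinsupp.sum] at h
      exact h
    by_contra hn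
    have hmem : n ∈ w.support := DFinsupp.mem_support_iff.2 hn
    rw [← Finset.add_sum_erase _ _ hmem] at hsum
    -- By `ih` the coordinates below `n` vanish, so only later terms remain.
    have htail : ∑ k ∈ w.support.erase n, (w k : M) ∈ V n := by
      refine Submodule.sum_mem _ fun k hk => ?_
      rw [Finset.mem_erase, DFinsupp.mem_support_iff] at hk
      have hnk : n < k := by
        rcases lt_trichotomy k n with h | h | h
        · exact absurd (ih k h) hk.2
        · exact absurd h hk.1
        · exact h
      exact hV n k hnk (w k).2
    have hwn : (w n : M) ∈ V n := by
      rw [eq_neg_of_add_eq_zero_left hsum]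
      exact neg_mem htail
    exact hn (Subtype.ext (Submodule.disjoint_def.1 (hUV n) _ (w n).2 hwn))

end Independence

/-! ### Generation in σ[M] -/

section Sigma

variable {R : Type u} [Ring R] {M : Type v} [AddCommGroup M] [Module R M]

theorem IsGenerated.of_surjective {X Y : Type v} [AddCommGroup X] [Module R X] [AddCommGroup Y]
    [Module R Y] (hX : IsGenerated R M X) (g : X →ₗ[R] Y) (hg : Function.Surjective g) :
    IsGenerated R M Y := by
  obtain ⟨ι, p, hp⟩ := hX
  exact ⟨ι, g ∘ₗ p, hg.comp hp⟩

theorem IsGenerated.inSigma {X : Type v} [AddCommGroup X] [Module R X]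
    (hX : IsGenerated R M X) : InSigma R M X :=
  ⟨X, _, _, hX, LinearMap.id, Function.injective_id⟩

theorem isGenerated_finsupp (ι : Type v) : IsGenerated R M (ι →₀ M) :=
  ⟨ι, LinearMap.id, Function.surjective_id⟩

theorem isGenerated_self : IsGenerated R M M :=
  (isGenerated_finsupp PUnit).of_surjective (Finsupp.lapply PUnit.unit) fun m =>
    ⟨Finsupp.single PUnit.unit m, by simp⟩

theorem inSigma_submodule (U : Submodule R M) : InSigma R M U :=
  ⟨M, _, _, isGenerated_self, U.subtype, U.injective_subtype⟩

/-- A nonzero submodule of a generator `M` of `σ[M]` contains the image of a nonzero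
endomorphism. -/
theorem IsGeneratorOfSigma.exists_ne_zero_range_le (hgen : IsGeneratorOfSigma R M)
    {U : Submodule R M} (hU : U ≠ ⊥) : ∃ a : Module.End R M, a ≠ 0 ∧ LinearMap.range a ≤ U := by
  obtain ⟨ι, p, hp⟩ := hgen U (inSigma_submodule U)
  by_contra! h
  refine hU ((Submodule.eq_bot_iff U).2 fun x hx => ?_)
  have hp0 : U.subtype ∘ₗ p = 0 := by
    refine Finsupp.lhom_ext' fun i => ?_
    by_contra hne
    refine h ((U.subtype ∘ₗ p) ∘ₗ Finsupp.lsingle i) (by simpa using hne) ?_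
    rintro _ ⟨m, rfl⟩
    exact (p (Finsupp.single i m)).2
  obtain ⟨w, hw⟩ := hp ⟨x, hx⟩
  have := LinearMap.congr_fun hp0 w
  simpa [hw] using this

end Sigma

/-! ### Essential submodules -/

section Essential

variable {R : Type*} [Ring R] {M L : Type*} [AddCommGroup M] [Module R M] [AddCommGroup L]
  [Module R L]

theorem IsEssentialSubmodule.comap {E : Submodule R L} (hE : IsEssentialSubmodule E)
    (h : M →ₗ[R] L) : IsEssentialSubmodule (E.comap h) := by
  intro K hK
  have hmap : K.map h = ⊥ := by
    refine hE _ ((Submodule.eq_bot_iff _).2 ?_)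
    rintro _ ⟨hyE, x, hx, rfl⟩
    have hx0 : x ∈ E.comap h ⊓ K := ⟨hyE, hx⟩
    rw [hK, Submodule.mem_bot] at hx0
    rw [hx0, map_zero]
  rw [← hK, eq_comm, inf_eq_right]
  intro x hx
  have : h x ∈ K.map h := Submodule.mem_map_of_mem hx
  rw [hmap, Submodule.mem_bot] at this
  rw [Submodule.mem_comap, this]
  exact E.zero_mem

/-- In a module of finite uniform dimension, injective endomorphisms have essential image. -/
theorem HasFiniteUniformDim.isEssential_range_of_injective (hM : HasFiniteUniformDim R M)
    {α : Module.End R M} (hα : Function.Injective α) :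
    IsEssentialSubmodule (LinearMap.range α) := by
  intro K hK
  by_contra hK0
  have hinj : ∀ n : ℕ, Function.Injective (α ^ n) := fun n => by
    rw [Module.End.coe_pow]
    exact hα.iterate n
  -- If `K` misses `α(M)`, then `αⁿ(K)` misses `αⁿ⁺¹(M)`, which contains all later terms.
  refine hM ⟨fun n => K.map (α ^ n),
    iSupIndep_nat_of_disjoint_tail _ (fun n => LinearMap.range (α ^ (n + 1))) (fun n => ?_)
      (fun n k hnk => ?_), fun n hn => ?_⟩
  · rw [Submodule.disjoint_def]
    rintro _ ⟨x, hx, rfl⟩ ⟨y, hy⟩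
    rw [pow_succ, Module.End.mul_apply] at hy
    have hxy : x ∈ LinearMap.range α ⊓ K := ⟨⟨y, hinj n hy⟩, hx⟩
    rw [hK, Submodule.mem_bot] at hxy
    rw [hxy, map_zero]
  · rintro _ ⟨x, -, rfl⟩
    obtain ⟨d, rfl⟩ := Nat.exists_eq_add_of_le hnk
    exact ⟨(α ^ d) x, by rw [pow_add α (n + 1) d, Module.End.mul_apply]⟩
  · exact hK0 (Submodule.map_injective_of_injective (hinj n) (hn.trans (Submodule.map_bot _).symm))

end Essential

/-! ### Goldie theory in the endomorphism ring -/

section EndomorphismRing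

variable {R : Type u} [Ring R] {M : Type v} [AddCommGroup M] [Module R M]

/-- The endomorphism ring of a semiprime module `M` that is projective in `σ[M]` is semiprime. -/
theorem IsSemiprimeModule.eq_zero_of_forall_mul_mul_eq_zero (hsemi : IsSemiprimeModule R M)
    (hproj : IsProjectiveInSigma R M) {f : Module.End R M}
    (hf : ∀ s : Module.End R M, f * s * f = 0) : f = 0 := by
  -- The range of `F` is the fully invariant submodule generated by `f(M)`.
  let F : (Module.End R M →₀ M) →ₗ[R] M := Finsupp.lsum ℕ fun s => s * f
  have hF : ∀ s m, F (Finsupp.single s m) = s (f m) := fun s m => by simp [F]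
  have hFzero : ∀ h : M →ₗ[R] (Module.End R M →₀ M), F ∘ₗ h ∘ₗ F = 0 := by
    intro h
    refine Finsupp.lhom_ext fun t m => ?_
    simp only [LinearMap.comp_apply, hF, LinearMap.zero_apply]
    simp only [F, Finsupp.lsum_apply, Finsupp.sum]
    refine Finset.sum_eq_zero fun s _ => ?_
    have h0 := LinearMap.congr_fun (hf ((Finsupp.lapply s ∘ₗ h) * t)) m
    simp only [Module.End.mul_apply, LinearMap.comp_apply, Finsupp.lapply_apply,
      LinearMap.zero_apply] at h0
    rw [Module.End.mul_apply, h0, map_zero]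
  have hbot : LinearMap.range F ≤ ⊥ := by
    refine hsemi.2 _ ?_ ?_
    · rintro g _ ⟨w, rfl⟩
      induction w using Finsupp.induction_linear with
      | zero => simp
      | add a b ha hb => rw [map_add]; exact add_mem ha hb
      | single s m =>
        rw [Submodule.mem_comap, hF]
        exact ⟨Finsupp.single (g * s) m, by rw [hF, Module.End.mul_apply]⟩
    · refine iSup_le fun g => ?_
      -- Projectivity writes every map `M → range F` as `F ∘ h`, which kills `range F` by `hFzero`.
      obtain ⟨h, hh⟩ := hproj _ _ (isGenerated_finsupp (Module.End R M)).inSigma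
        (inSigma_submodule (LinearMap.range F)) F.rangeRestrict g F.surjective_rangeRestrict
      rintro _ ⟨_, ⟨w, rfl⟩, rfl⟩
      rw [← hh, Submodule.mem_bot]
      exact LinearMap.congr_fun (hFzero h) w
  ext m
  have : f m ∈ LinearMap.range F := ⟨Finsupp.single 1 m, by rw [hF, Module.End.one_apply]⟩
  exact (Submodule.mem_bot R).1 (hbot this)

theorem leftAnnihilator_singleton (f : Module.End R M) :
    leftAnnihilator {f} = LinearMap.ker f := by
  simp [leftAnnihilator]

/-- The maximum condition for kernels of endomorphisms. -/
theorem HasACCLeftAnnihilators.exists_maximal_ker (hacc : HasACCLeftAnnihilators R M)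
    (T : Set (Module.End R M)) (hT : T.Nonempty) :
    ∃ c ∈ T, ∀ d ∈ T, LinearMap.ker c ≤ LinearMap.ker d → LinearMap.ker d = LinearMap.ker c := by
  by_contra! h
  obtain ⟨c₀, hc₀⟩ := hT
  choose! next hnext hle hne using h
  let c : ℕ → Module.End R M := fun n => next^[n] c₀
  have hsucc : ∀ n, c (n + 1) = next (c n) := fun n => Function.iterate_succ_apply' next n c₀
  have hcT : ∀ n, c n ∈ T := fun n => by
    induction n with
    | zero => exact hc₀
    | succ n ih => rw [hsucc]; exact hnext _ ih
  obtain ⟨n, hn⟩ := hacc (fun n => LinearMap.ker (c n))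
    (monotone_nat_of_le_succ fun n => by rw [hsucc]; exact hle _ (hcT n))
    fun n => ⟨{c n}, (leftAnnihilator_singleton _).symm⟩
  have := hn (n + 1) n.le_succ
  rw [hsucc] at this
  exact hne _ (hcT n) this

/-- In a semiprime ring `End(M)` with the maximum condition on kernels, a nonzero submodule of `M`
contains the image of an endomorphism that is not nilpotent. -/
theorem exists_not_isNilpotent_range_le (hprog : IsProgenerator R M)
    (hsemi : IsSemiprimeModule R M) (hacc : HasACCLeftAnnihilators R M)
    {U : Submodule R M} (hU : U ≠ ⊥) :
    ∃ a : Module.End R M, ¬ IsNilpotent a ∧ LinearMap.range a ≤ U := by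
  by_contra! hnil
  obtain ⟨a, ha0, haU⟩ := hprog.generator.exists_ne_zero_range_le hU
  have hleft : ∀ b : Module.End R M, IsNilpotent (b * a) := by
    intro b
    have hab : IsNilpotent (a * b) := by
      by_contra hab
      exact hnil _ hab ((LinearMap.range_comp_le_range b a).trans haU)
    obtain ⟨k, hk⟩ := hab
    exact ⟨k + 1, by rw [pow_succ, ← mul_assoc, mul_pow_mul, hk, mul_zero, zero_mul]⟩
  -- All elements of the left ideal `End(M)a` are nilpotent; one with maximal kernel, `c = da`, will
  -- satisfy `c x c = 0` for all `x`.
  obtain ⟨c, ⟨hc0, d, rfl⟩, hmax⟩ := hacc.exists_maximal_ker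
    {c | c ≠ 0 ∧ ∃ d, c = d * a} ⟨a, ha0, 1, (one_mul a).symm⟩
  refine hc0 (hsemi.eq_zero_of_forall_mul_mul_eq_zero hprog.projective fun x => ?_)
  by_cases hx : x * (d * a) = 0
  · rw [mul_assoc, hx, mul_zero]
  obtain ⟨k, hk, hk'⟩ : ∃ k, (x * (d * a)) ^ (k + 1) ≠ 0 ∧ (x * (d * a)) ^ (k + 2) = 0 := by
    have hn : IsNilpotent (x * (d * a)) := by rw [← mul_assoc]; exact hleft _
    by_contra! hall
    have hne : ∀ k, (x * (d * a)) ^ (k + 1) ≠ 0 := fun k => by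
      induction k with
      | zero => simpa using hx
      | succ k ih => exact hall k ih
    obtain ⟨k, hk⟩ := hn
    exact hne k (by rw [pow_succ, hk, zero_mul])
  -- The last nonzero power of `xc` has the kernel of `c` by maximality, and it kills the image of
  -- `xc`.
  have hker : LinearMap.ker ((x * (d * a)) ^ (k + 1)) = LinearMap.ker (d * a) := by
    refine hmax _ ⟨hk, (x * (d * a)) ^ k * (x * d), by simp only [pow_succ, mul_assoc]⟩ ?_
    rw [pow_succ, ← mul_assoc]
    exact LinearMap.ker_le_ker_comp _ _
  ext m
  have hm : (x * (d * a)) m ∈ LinearMap.ker ((x * (d * a)) ^ (k + 1)) := by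
    rw [LinearMap.mem_ker, ← Module.End.mul_apply, ← pow_succ, hk', LinearMap.zero_apply]
  rw [hker, LinearMap.mem_ker] at hm
  rwa [mul_assoc, Module.End.mul_apply]

/-- Fitting's argument: the kernels of the powers of a non-nilpotent endomorphism stabilise, and a
power at that stage has image disjoint from its kernel. -/
theorem exists_ne_zero_range_le_disjoint_ker (hprog : IsProgenerator R M)
    (hsemi : IsSemiprimeModule R M) (hacc : HasACCLeftAnnihilators R M)
    {U : Submodule R M} (hU : U ≠ ⊥) :
    ∃ a : Module.End R M, a ≠ 0 ∧ LinearMap.range a ≤ U ∧ ∀ x, a (a x) = 0 → a x = 0 := by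
  obtain ⟨a, hnil, haU⟩ := exists_not_isNilpotent_range_le hprog hsemi hacc hU
  obtain ⟨c, ⟨n, rfl⟩, hmax⟩ := hacc.exists_maximal_ker (Set.range fun n : ℕ => a ^ (n + 1))
    (Set.range_nonempty _)
  refine ⟨a ^ (n + 1), fun h => hnil ⟨_, h⟩, ?_, fun x hx => ?_⟩
  · rw [pow_succ']
    exact (LinearMap.range_comp_le_range _ _).trans haU
  · have hpow : a ^ (n + n + 1 + 1) = a ^ (n + 1) * a ^ (n + 1) := by
      rw [← pow_add]; congr 1; ring
    have hker := hmax (a ^ (n + n + 1 + 1)) ⟨n + n + 1, rfl⟩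
      (by rw [hpow]; exact LinearMap.ker_le_ker_comp _ _)
    have hx' : x ∈ LinearMap.ker (a ^ (n + n + 1 + 1)) := by
      rw [hpow]; exact hx
    rw [hker] at hx'
    exact hx'

/-- Every essential submodule of a semiprime Goldie progenerator `M` contains the image of an
injective endomorphism. -/
theorem exists_injective_range_le_of_isEssential (hprog : IsProgenerator R M)
    (hsemi : IsSemiprimeModule R M) (hgoldie : IsGoldieModule R M)
    {E : Submodule R M} (hE : IsEssentialSubmodule E) :
    ∃ α : Module.End R M, Function.Injective α ∧ LinearMap.range α ≤ E := by
  let P : Module.End R M → Prop := fun β =>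
    LinearMap.range β ≤ E ∧ ∀ x, β (β x) = 0 → β x = 0
  suffices h : ∃ β, P β ∧ E ⊓ LinearMap.ker β = ⊥ by
    obtain ⟨β, hβ, hbot⟩ := h
    exact ⟨β, LinearMap.ker_eq_bot.1 (hE _ hbot), hβ.1⟩
  by_contra! hcon
  have hstep : ∀ β, P β → ∃ a : Module.End R M, a ≠ 0 ∧ LinearMap.range a ≤ E ⊓ LinearMap.ker β ∧
      ∀ x, a (a x) = 0 → a x = 0 := fun β hβ =>
    exists_ne_zero_range_le_disjoint_ker hprog hsemi hgoldie.acc (hcon β hβ)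
  choose! a ha0 hrange hsq using hstep
  have hβa : ∀ β, P β → ∀ x, β (a β x) = 0 := fun β hβ x => (hrange β hβ ⟨x, rfl⟩).2
  -- Applying `β` kills the `a β` term and leaves `β (β x) = 0`.
  have hker : ∀ β, P β → ∀ x, (β + a β) x = 0 → β x = 0 ∧ a β x = 0 := by
    intro β hβ x hx
    rw [LinearMap.add_apply] at hx
    have h1 : β x = 0 := hβ.2 x (by simpa [hβa β hβ] using congrArg β hx)
    exact ⟨h1, by simpa [h1] using hx⟩
  have hnext : ∀ β, P β → P (β + a β) := by
    intro β hβ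
    refine ⟨?_, fun x hx => ?_⟩
    · rintro _ ⟨x, rfl⟩
      exact add_mem (hβ.1 ⟨x, rfl⟩) (hrange β hβ ⟨x, rfl⟩).1
    · obtain ⟨h1, h2⟩ := hker β hβ _ hx
      rw [LinearMap.add_apply, map_add, hβa β hβ, add_zero] at h1
      have h3 := hβ.2 x h1
      rw [LinearMap.add_apply, h3, zero_add] at h2
      rw [LinearMap.add_apply, h3, hsq β hβ x h2, add_zero]
  let b : ℕ → Module.End R M := fun n => (fun β => β + a β)^[n] 0
  have hsucc : ∀ n, b (n + 1) = b n + a (b n) := fun n => Function.iterate_succ_apply' _ n _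
  have hb : ∀ n, P (b n) := fun n => by
    induction n with
    | zero => exact ⟨by rintro _ ⟨x, rfl⟩; exact E.zero_mem, fun x _ => rfl⟩
    | succ n ih => rw [hsucc]; exact hnext _ ih
  have hanti : Antitone fun n => LinearMap.ker (b n) :=
    antitone_nat_of_succ_le fun n x hx => by
      rw [hsucc] at hx
      exact (hker _ (hb n) x hx).1
  -- The image of `a (b n)` misses `ker (b (n + 1))`, while all later images lie in it.
  refine hgoldie.finiteUniformDim ⟨fun n => LinearMap.range (a (b n)),
    iSupIndep_nat_of_disjoint_tail _ (fun n => LinearMap.ker (b (n + 1))) (fun n => ?_)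
      (fun n k hnk => ?_), fun n hn => ha0 _ (hb n) (LinearMap.range_eq_bot.1 hn)⟩
  · rw [Submodule.disjoint_def]
    rintro _ ⟨x, rfl⟩ hx
    rw [hsucc] at hx
    exact hsq _ (hb n) x (hker _ (hb n) _ hx).2
  · exact ((hrange _ (hb k)).trans inf_le_right).trans (hanti hnk)

end EndomorphismRing

/-! ### Singular modules and the main theorem -/

section Singular

variable {R : Type u} [Ring R] {M : Type v} [AddCommGroup M] [Module R M]

theorem isMSingular_quotient_range {α : Module.End R M} (hα : Function.Injective α)
    (hess : IsEssentialSubmodule (LinearMap.range α)) :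
    IsMSingular R M (M ⧸ LinearMap.range α) :=
  ⟨(isGenerated_self.of_surjective _ (Submodule.mkQ_surjective _)).inSigma,
    M, M, _, _, _, _, α, (LinearMap.range α).mkQ, isGenerated_self.inSigma,
    isGenerated_self.inSigma, hα, LinearMap.exact_map_mkQ_range α,
    Submodule.mkQ_surjective _, hess⟩

end Singular

end SigmaCat

theorem proposition2p15 {R : Type u} [Ring R] {M : Type v} [AddCommGroup M] [Module R M]
    (hprog : SigmaCat.IsProgenerator R M)
    (hsemi : SigmaCat.IsSemiprimeModule R M) (hgoldie : SigmaCat.IsGoldieModule R M)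
    {N : Type v} [AddCommGroup N] [Module R N] (hN : SigmaCat.InSigma R M N) :
    SigmaCat.mSingularSubmodule R M N =
      ⨆ (f : M →ₗ[R] N) (_ : ∃ α : Module.End R M, Function.Injective α ∧
          SigmaCat.IsEssentialSubmodule (LinearMap.range α) ∧ f ∘ₗ α = 0),
        LinearMap.range f := by
  apply le_antisymm
  · refine sSup_le ?_
    rintro _ ⟨X, _, _, f, ⟨-, K, L, _, _, _, _, i, p, -, hL, -, hexact, hp, hess⟩, rfl⟩
    -- Covering `L` by copies of `M` reduces the claim to one map `h : M → L`.
    obtain ⟨ι, q, hq⟩ := hprog.generator L hL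
    rintro _ ⟨x, rfl⟩
    obtain ⟨y, rfl⟩ := hp x
    obtain ⟨w, rfl⟩ := hq y
    induction w using Finsupp.induction_linear with
    | zero => simp
    | add a b ha hb => simp only [map_add]; exact add_mem ha hb
    | single j m =>
      let h : M →ₗ[R] L := q ∘ₗ Finsupp.lsingle j
      obtain ⟨α, hα, hαE⟩ := SigmaCat.exists_injective_range_le_of_isEssential hprog hsemi hgoldie
        (hess.comap h)
      have hzero : (f ∘ₗ p ∘ₗ h) ∘ₗ α = 0 := by
        ext z
        have hz : h (α z) ∈ LinearMap.range i := hαE ⟨z, rfl⟩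
        have hpz : p (h (α z)) = 0 := (hexact _).2 hz
        simp only [LinearMap.comp_apply, hpz, map_zero, LinearMap.zero_apply]
      refine (le_iSup₂_of_le (f ∘ₗ p ∘ₗ h) ?_ le_rfl : LinearMap.range (f ∘ₗ p ∘ₗ h) ≤ _) ⟨m, rfl⟩
      exact ⟨α, hα, hgoldie.finiteUniformDim.isEssential_range_of_injective hα, hzero⟩
  · refine iSup₂_le ?_
    rintro f ⟨α, hα, hess, hfα⟩
    refine le_sSup ⟨M ⧸ LinearMap.range α, _, _, (LinearMap.range α).liftQ f
      (LinearMap.range_le_ker_iff.2 hfα), SigmaCat.isMSingular_quotient_range hα hess, ?_⟩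
    rw [Submodule.range_liftQ]
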